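/- Let $\mathbb{K}$ be a field, let $n\ge 1$ and $d\ge 1$ be integers, write $\underline t=(t_1,\dots,t_n)$, $\underline X=(X_1,\dots,X_{n+1})$, and let $f_{d-1},f_d\in\mathbb{K}[\underline t]$ be homogeneous polynomials of degrees $d-1$ and $d$ without common factors. Consider the monoid parametrization $\theta\mapsto(\theta_1f_{d-1}(\theta):\dots:\theta_nf_{d-1}(\theta):f_d(\theta))$, let $\mathcal I=\langle t_1f_{d-1},\dots,t_nf_{d-1},f_d\rangle\subset\mathbb{K}[\underline t]$, and let $\mathcal K$ be the defining ideal of its Rees algebra, that is, the kernel of the $\mathbb{K}[\underline t]$-algebra morphism $\mathbb{K}[\underline t,\underline X]\to\mathrm{Rees}(\mathcal I)=\mathbb{K}[\underline t][\mathcal I Z]$ with $X_i\mapsto t_if_{d-1}Z$ for $i\le n$ and $X_{n+1}\mapsto f_dZ$. Put $E(\underline X)=f_{d-1}(X_1,\dots,X_n)X_{n+1}-f_d(X_1,\dots,X_n)$. This is the implicit equation of the parametrized hypersurface: $E$ is irreducible and generates the ideal of all $P\in\mathbb{K}[\underline X]$ with $P(t_1f_{d-1},\dots,t_nf_{d-1},f_d)=0$.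 Let $p_{i,j}=t_iX_j-t_jX_i$ for $1\le i<j\le n$, and construct $F_{d-1},\dots,F_0$ as follows. Write $f_d=\sum_{j=1}^n t_jf_{d,j}$ with $f_{d,j}\in\mathbb{K}[\underline t]$ homogeneous of degree $d-1$ and set $F_{d-1}=f_{d-1}X_{n+1}-\sum_{j=1}^n f_{d,j}X_j$. For $j=d-1,d-2,\dots,1$, write $F_j=\sum_{i=1}^n F_{j,i}t_i$ with $F_{j,i}\in\mathbb{K}[\underline t,\underline X]$ bihomogeneous of degree $j-1$ in $\underline t$ and $d-j$ in $\underline X$, and set $F_{j-1}=\sum_{i=1}^n F_{j,i}X_i$. Such decompositions can be chosen at every step, and, whatever the choices, $F_0=E$ and $$\{p_{i,j},\ 1\le i<j\le n,\ F_0,F_1,\dots,F_{d-1}\}$$ is a minimal set of generators of $\mathcal K$: it generates $\mathcal K$, and none of the listed elements lies in the ideal generated by the others. -/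

import Mathlib

open MvPolynomial

noncomputable section

namespace MonoidRees

variable {K : Type*} [Field K] {n : ℕ}

/-- The ring `K[t, X] = K[t_1, …, t_n, X_1, …, X_{n+1}]`: `Sum.inl i` indexes the variables `t`,
`Sum.inr k` the variables `X`. -/
abbrev TX (K : Type*) [Field K] (n : ℕ) : Type _ := MvPolynomial (Fin n ⊕ Fin (n + 1)) K

/-- The variable `t_i`. -/
def tVar (K : Type*) [Field K] {n : ℕ} (i : Fin n) : TX K n := X (Sum.inl i)

/-- The variable `X_k`, `k = 1, …, n + 1`. -/
def xVar (K : Type*) [Field K] {n : ℕ} (k : Fin (n + 1)) : TX K n := X (Sum.inr k)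

/-- A polynomial in `t`, seen in `K[t, X]`. -/
def ofT (p : MvPolynomial (Fin n) K) : TX K n := rename Sum.inl p

/-- A polynomial in `X`, seen in `K[t, X]`. -/
def ofX (p : MvPolynomial (Fin (n + 1)) K) : TX K n := rename Sum.inr p

/-- Bihomogeneous of bidegree `(i, j)`: degree `i` in `t` and degree `j` in `X`. -/
def IsBihomogeneous (p : TX K n) (i j : ℕ) : Prop :=
  IsWeightedHomogeneous (Sum.elim (fun _ => 1) (fun _ => 0) : Fin n ⊕ Fin (n + 1) → ℕ) p i ∧
  IsWeightedHomogeneous (Sum.elim (fun _ => 0) (fun _ => 1) : Fin n ⊕ Fin (n + 1) → ℕ) p j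

/-- The map `K[t, X] → Rees(I) = K[t][I Z]`, `t_i ↦ t_i`, `X_k ↦ u_k Z`,
where `I = ⟨u_1, …, u_{n+1}⟩`. -/
def reesMap (u : Fin (n + 1) → MvPolynomial (Fin n) K) :
    TX K n →ₐ[K] reesAlgebra (Ideal.span (Set.range u)) :=
  aeval (Sum.elim
    (fun i => algebraMap (MvPolynomial (Fin n) K) (reesAlgebra (Ideal.span (Set.range u))) (X i))
    (fun k => ⟨Polynomial.monomial 1 (u k), reesAlgebra.monomial_mem.mpr
      (by rw [pow_one]; exact Ideal.subset_span ⟨k, rfl⟩)⟩))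

/-- The defining ideal of the Rees algebra of `I = ⟨u_1, …, u_{n+1}⟩`. -/
def reesIdeal (u : Fin (n + 1) → MvPolynomial (Fin n) K) : Ideal (TX K n) :=
  RingHom.ker (reesMap u)

/-- The monoid parametrization `(t_1 f : … : t_n f : g)`, with `f = f_{d-1}` and `g = f_d`. -/
def monoidParam (f g : MvPolynomial (Fin n) K) : Fin (n + 1) → MvPolynomial (Fin n) K :=
  Fin.snoc (α := fun _ => MvPolynomial (Fin n) K) (fun i => X i * f) g

/-- `E = f(X_1, …, X_n) X_{n+1} - g(X_1, …, X_n)`. -/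
def monoidEquation (f g : MvPolynomial (Fin n) K) : MvPolynomial (Fin (n + 1)) K :=
  rename Fin.castSucc f * X (Fin.last n) - rename Fin.castSucc g

/-- `E` is the implicit equation of the hypersurface parametrized by `u`: it is irreducible and
generates the ideal of all `P ∈ K[X]` with `P(u_1, …, u_{n+1}) = 0`. -/
def IsImplicitEquation (u : Fin (n + 1) → MvPolynomial (Fin n) K)
    (E : MvPolynomial (Fin (n + 1)) K) : Prop :=
  Irreducible E ∧ RingHom.ker (aeval u : MvPolynomial (Fin (n + 1)) K →ₐ[K] _) = Ideal.span {E}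

/-- `p_{ij} = t_i X_j - t_j X_i`. -/
def minor (K : Type*) [Field K] {n : ℕ} (i j : Fin n) : TX K n :=
  tVar K i * xVar K j.castSucc - tVar K j * xVar K i.castSucc

/-- `F_0, …, F_{d-1}` (the values `F j` with `j ≥ d` play no role) is a sequence produced by the
recursive construction from `f = f_{d-1}` and `g = f_d`, for some choice of the homogeneous
decompositions made at each step. -/
structure IsMonoidSequence (d : ℕ) (f g : MvPolynomial (Fin n) K) (F : ℕ → TX K n) : Prop where
  start : ∃ a : Fin n → MvPolynomial (Fin n) K,
    (∀ i, (a i).IsHomogeneous (d - 1)) ∧ g = ∑ i, X i * a i ∧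
    F (d - 1) = ofT f * xVar K (Fin.last n) - ∑ i, ofT (a i) * xVar K i.castSucc
  step : ∀ j, j + 1 < d → ∃ G : Fin n → TX K n,
    (∀ i, IsBihomogeneous (G i) j (d - (j + 1))) ∧
    F (j + 1) = ∑ i, G i * tVar K i ∧
    F j = ∑ i, G i * xVar K i.castSucc

/-- The family of all `p_{ij}`, `i < j`, followed by `F_0, …, F_{d-1}`. -/
def monoidGenerators (d : ℕ) (F : ℕ → TX K n) :
    {q : Fin n × Fin n // q.1 < q.2} ⊕ Fin d → TX K n :=
  Sum.elim (fun q => minor K q.1.1 q.1.2) (fun j => F j)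

/-- The family `s` generates the ideal `J`, and no member is in the ideal generated by the members
with other indices (in particular the members are pairwise distinct). -/
def IsMinimalGenerators {R ι : Type*} [CommRing R] (J : Ideal R) (s : ι → R) : Prop :=
  Ideal.span (Set.range s) = J ∧ ∀ a, s a ∉ Ideal.span (s '' {a}ᶜ)

end MonoidRees

end

/-!
The substitution `t_i ↦ X_i` sends every `F_j` to `E`, and a bihomogeneous polynomial is in its
kernel exactly when it is a combination of the `p_{ij}`, since modulo the `p_{ij}` two monomials of
the same bidegree with the same image agree. Substituting the parametrization after it multiplies a
polynomial of degree `a` in `t` by `f_{d-1} ^ a`, so a bihomogeneous `p` is in `𝒦` if and only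
if `E` divides its image `P`.

Let `P = Q E` be the image of a `p ∈ 𝒦` of bidegree `(a, b)`, and let `m = min a (d - 1)`. As `E`
has positive degree in `X_{n+1}`, which no `t_i` is sent to, the degree of `Q` in `X_{n+1}` is small
enough for `Q` to be the image of some `q` of bidegree `(a - m, b - (d - m))`. Then `p - q F_m` is
bihomogeneous and is sent to `0`, so `p` is in the ideal generated by the `p_{ij}` and `F_m`.

For minimality, take bihomogeneous coefficients. In a relation expressing `F_j` by the other
generators, comparing bidegrees leaves only the `p_{ij}`, whose images vanish, whereas `E ≠ 0`. In
one expressing some `p_{ij}`, at most a multiple of `F_{d-1}` by a polynomial in `t` survives, and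
its image shows that it is zero.
-/

noncomputable section

namespace MonoidRees

section WeightedHomogeneous

variable {σ τ R M N : Type*} [CommSemiring R]

theorem weightedHomogeneousComponent_add_mul [AddCancelCommMonoid M] {w : σ → M}
    {q : MvPolynomial σ R} {E : M} (hq : IsWeightedHomogeneous w q E) (D : M)
    (p : MvPolynomial σ R) :
    weightedHomogeneousComponent w (D + E) (p * q) = weightedHomogeneousComponent w D p * q := by
  classical
  induction p using MvPolynomial.induction_on' with
  | add p₁ p₂ h₁ h₂ => simp only [add_mul, map_add, h₁, h₂]
  | monomial m r =>
    have hm := isWeightedHomogeneous_monomial w m r rfl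
    rw [weightedHomogeneousComponent_of_mem (hm.mul hq), weightedHomogeneousComponent_of_mem hm]
    by_cases h : D = Finsupp.weight w m <;> simp [h]

theorem weightedHomogeneousComponent_mul_eq_zero [AddCommMonoid M] {w : σ → M}
    {q : MvPolynomial σ R} {D E : M} (hq : IsWeightedHomogeneous w q E) (hE : ∀ k, k + E ≠ D)
    (p : MvPolynomial σ R) :
    weightedHomogeneousComponent w D (p * q) = 0 := by
  classical
  induction p using MvPolynomial.induction_on' with
  | add p₁ p₂ h₁ h₂ => simp only [add_mul, map_add, h₁, h₂, add_zero]
  | monomial m r =>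
    have hm := isWeightedHomogeneous_monomial w m r rfl
    rw [weightedHomogeneousComponent_of_mem (hm.mul hq), if_neg (hE _).symm]

theorem exists_isWeightedHomogeneous_coeff_of_mem_span [AddCancelCommMonoid M] {ι : Type*}
    [Fintype ι] {w : σ → M} {s : ι → MvPolynomial σ R} {D : ι → M}
    (hs : ∀ i, IsWeightedHomogeneous w (s i) (D i)) {A : Set ι} {p : MvPolynomial σ R} {E : M}
    (hp : IsWeightedHomogeneous w p E) (hpA : p ∈ Ideal.span (s '' A)) :
    ∃ c : ι → MvPolynomial σ R, (∀ i ∉ A, c i = 0) ∧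
      (∀ i k, k + D i = E → IsWeightedHomogeneous w (c i) k) ∧
      (∀ i, (∀ k, k + D i ≠ E) → c i = 0) ∧ p = ∑ i, c i * s i := by
  classical
  obtain ⟨b, hbA, hb⟩ : ∃ b : ι → MvPolynomial σ R, (∀ i ∉ A, b i = 0) ∧ ∑ i, b i * s i = p := by
    obtain ⟨b, hbA, rfl⟩ := (Finsupp.mem_span_image_iff_linearCombination _).mp hpA
    refine ⟨b, fun i hi => Finsupp.notMem_support_iff.mp fun h => hi (hbA h), ?_⟩
    simp [Finsupp.linearCombination_apply, Finsupp.sum_fintype]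
  have hcomp (i : ι) : ∃ c : MvPolynomial σ R, (b i = 0 → c = 0) ∧
      (∀ k, k + D i = E → IsWeightedHomogeneous w c k) ∧ ((∀ k, k + D i ≠ E) → c = 0) ∧
      weightedHomogeneousComponent w E (b i * s i) = c * s i := by
    by_cases h : ∃ k, k + D i = E
    · obtain ⟨k, rfl⟩ := h
      refine ⟨weightedHomogeneousComponent w k (b i), fun hbi => by simp [hbi], fun l hl => ?_,
        fun h => (h k rfl).elim, weightedHomogeneousComponent_add_mul (hs i) k (b i)⟩
      rw [add_right_cancel hl]
      exact weightedHomogeneousComponent_isWeightedHomogeneous k (b i)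
    · push Not at h
      exact ⟨0, fun _ => rfl, fun k hk => (h k hk).elim, fun _ => rfl, by
        rw [zero_mul, weightedHomogeneousComponent_mul_eq_zero (hs i) h]⟩
  choose c hcb hch hc0 hc using hcomp
  refine ⟨c, fun i hi => hcb i (hbA i hi), hch, hc0, ?_⟩
  rw [← hp.weightedHomogeneousComponent_same, ← hb, map_sum]
  exact Finset.sum_congr rfl fun i _ => hc i

theorem exists_eq_sum_mul_X [AddCancelCommMonoid M] {ι : Type*} [Fintype ι] {w : σ → M} {δ D : M}
    (v : ι → σ) (hv : ∀ i, w (v i) = δ)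
    (hD : ∀ m : σ →₀ ℕ, Finsupp.weight w m = D + δ → ∃ i, m (v i) ≠ 0)
    {p : MvPolynomial σ R} (hp : IsWeightedHomogeneous w p (D + δ)) :
    ∃ G : ι → MvPolynomial σ R, (∀ i, IsWeightedHomogeneous w (G i) D) ∧
      p = ∑ i, G i * X (v i) := by
  have hspan : p ∈ Ideal.span ((fun i => X (v i)) '' (Set.univ : Set ι)) := by
    rw [Set.image_univ, ← Function.comp_def, Set.range_comp, mem_ideal_span_X_image]
    intro m hm
    obtain ⟨i, hi⟩ := hD m (hp (mem_support_iff.mp hm))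
    exact ⟨v i, Set.mem_range_self i, hi⟩
  obtain ⟨G, -, hG, -, hpG⟩ := exists_isWeightedHomogeneous_coeff_of_mem_span
    (fun i => hv i ▸ isWeightedHomogeneous_X R w (v i)) hp hspan
  exact ⟨G, fun i => hG i D rfl, hpG⟩

theorem isWeightedHomogeneous_aeval [AddCommMonoid M] [AddCommMonoid N] {w : σ → M} {w' : τ → N}
    (φ : M →+ N) {v : σ → MvPolynomial τ R} (hv : ∀ k, IsWeightedHomogeneous w' (v k) (φ (w k)))
    {p : MvPolynomial σ R} {D : M} (hp : IsWeightedHomogeneous w p D) :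
    IsWeightedHomogeneous w' (aeval v p) (φ D) := by
  induction hp using IsWeightedHomogeneous.induction_on with
  | zero => simpa using isWeightedHomogeneous_zero R w' _
  | add p q _ _ hp hq => simpa using hp.add hq
  | monomial m r hm =>
    rw [aeval_monomial, ← hm, Finsupp.weight_apply, map_finsuppSum]
    refine IsWeightedHomogeneous.C_mul (IsWeightedHomogeneous.prod _ _ _ fun k _ => ?_) r
    simpa using (hv k).pow (m k)

theorem weightedHomogeneousComponent_aeval [AddCommMonoid M] [AddCommMonoid N] {w : σ → M}
    {w' : τ → N} {φ : M →+ N} (hφ : Function.Injective φ) {v : σ → MvPolynomial τ R}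
    (hv : ∀ k, IsWeightedHomogeneous w' (v k) (φ (w k))) (D : M) (p : MvPolynomial σ R) :
    weightedHomogeneousComponent w' (φ D) (aeval v p) =
      aeval v (weightedHomogeneousComponent w D p) := by
  classical
  induction p using MvPolynomial.induction_on' with
  | add p q hp hq => simp only [map_add, hp, hq]
  | monomial m r =>
    have hm := isWeightedHomogeneous_monomial w m r rfl
    rw [weightedHomogeneousComponent_of_mem (isWeightedHomogeneous_aeval φ hv hm),
      weightedHomogeneousComponent_of_mem hm, hφ.eq_iff, apply_ite (aeval v), map_zero]

theorem isWeightedHomogeneous_rename [AddCommMonoid M] [AddCommMonoid N] {w : σ → M} {w' : τ → N}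
    (φ : M →+ N) {c : σ → τ} (hc : ∀ k, w' (c k) = φ (w k))
    {p : MvPolynomial σ R} {D : M} (hp : IsWeightedHomogeneous w p D) :
    IsWeightedHomogeneous w' (rename c p) (φ D) := by
  have hren : rename c = aeval (R := R) (X ∘ c) := algHom_ext fun k => by simp
  rw [hren]
  exact isWeightedHomogeneous_aeval φ (fun k => hc k ▸ isWeightedHomogeneous_X R w' (c k)) hp

theorem aeval_pow_weight_mul {A : Type*} [CommSemiring A] [Algebra R A] {w : σ → ℕ} (c : A)
    (v : σ → A) {p : MvPolynomial σ R} {D : ℕ} (hp : IsWeightedHomogeneous w p D) :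
    aeval (fun k => c ^ w k * v k) p = c ^ D * aeval v p := by
  induction hp using IsWeightedHomogeneous.induction_on with
  | zero => simp only [map_zero, mul_zero]
  | add p q _ _ hp hq => simp only [map_add, hp, hq, mul_add]
  | monomial m r hm =>
    have hc : (m.prod fun k l => (c ^ w k) ^ l) = c ^ D := by
      rw [← hm, Finsupp.weight_apply, Finsupp.sum, Finsupp.prod, ← Finset.prod_pow_eq_pow_sum]
      exact Finset.prod_congr rfl fun k _ => by rw [← pow_mul, smul_eq_mul, mul_comm]
    simp only [aeval_monomial, mul_pow, Finsupp.prod_mul, hc, mul_left_comm]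

theorem weight_eq_zero_of_mem_vars {w : σ → ℕ} {p : MvPolynomial σ R}
    (hp : IsWeightedHomogeneous w p 0) {k : σ} (hk : k ∈ p.vars) : w k = 0 := by
  obtain ⟨m, hm, hkm⟩ := (mem_vars_iff_mem_support k).mp hk
  by_contra hwk
  have hle := Finsupp.le_weight w hwk m
  rw [hp (mem_support_iff.mp hm)] at hle
  exact Finsupp.mem_support_iff.mp hkm (Nat.le_zero.mp hle)

end WeightedHomogeneous

section Rename

variable {σ τ R : Type*}

theorem vars_subset_of_dvd [CommRing R] [IsDomain R] {p q : MvPolynomial σ R} (hq : q ≠ 0)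
    (h : p ∣ q) : p.vars ⊆ q.vars := by
  obtain ⟨r, rfl⟩ := h
  intro k
  rw [mem_vars_iff_degreeOf_ne_zero, mem_vars_iff_degreeOf_ne_zero,
    degreeOf_mul_eq (left_ne_zero_of_mul hq) (right_ne_zero_of_mul hq)]
  omega

theorem isRelPrime_rename [CommRing R] [IsDomain R] {c : σ → τ} (hc : Function.Injective c)
    {f g : MvPolynomial σ R} (hf : f ≠ 0) (h : IsRelPrime f g) :
    IsRelPrime (rename c f) (rename c g) := by
  classical
  intro a haf hag
  have hvars : (a.vars : Set τ) ⊆ Set.range c := by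
    intro k hk
    have hkf := vars_subset_of_dvd ((map_ne_zero_iff _ (rename_injective c hc)).mpr hf) haf hk
    obtain ⟨j, -, rfl⟩ := mem_vars_rename _ _ hkf
    exact Set.mem_range_self j
  obtain ⟨a, rfl⟩ := exists_rename_eq_of_vars_subset_range a c hc hvars
  have hdvd (q : MvPolynomial σ R) (hq : rename c a ∣ rename c q) : a ∣ q := by
    simpa only [killCompl_rename_app] using map_dvd (killCompl hc) hq
  exact (h (hdvd f haf) (hdvd g hag)).map (rename c)

theorem mem_of_rename_eq_zero [CommRing R] {c : σ → τ} {I : Submodule R (MvPolynomial σ R)}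
    {p : MvPolynomial σ R}
    (hI : ∀ m ∈ p.support, ∀ m' ∈ p.support, m.mapDomain c = m'.mapDomain c →
      monomial m (1 : R) - monomial m' 1 ∈ I)
    (hp : rename c p = 0) : p ∈ I := by
  let lift (m : p.support) : MvPolynomial σ R ⧸ I := I.mkQ (monomial m.1 1)
  have hlift : lift.FactorsThrough fun m => m.1.mapDomain c := fun m m' h =>
    (Submodule.Quotient.eq I).mpr (hI m m.2 m' m'.2 h)
  let L : MvPolynomial τ R →ₗ[R] MvPolynomial σ R ⧸ I :=
    (basisMonomials τ R).constr R (Function.extend (fun m : p.support => m.1.mapDomain c) lift 0)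
  have hL (m : σ →₀ ℕ) (hm : m ∈ p.support) (r : R) :
      L (rename c (monomial m r)) = I.mkQ (monomial m r) := by
    have h := (basisMonomials τ R).constr_basis R
      (Function.extend (fun m : p.support => m.1.mapDomain c) lift 0) (m.mapDomain c)
    rw [hlift.extend_apply 0 ⟨m, hm⟩, coe_basisMonomials] at h
    rw [rename_monomial, ← mul_one r, ← smul_eq_mul, ← smul_monomial, ← smul_monomial, map_smul,
      map_smul, h]
  have hLp : L (rename c p) = I.mkQ p := by
    conv_lhs => rw [p.as_sum]
    conv_rhs => rw [p.as_sum]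
    simp only [map_sum]
    exact Finset.sum_congr rfl fun m hm => hL m hm _
  rwa [hp, map_zero, eq_comm, Submodule.mkQ_apply, Submodule.Quotient.mk_eq_zero] at hLp

end Rename

variable {K : Type*} [Field K] {n : ℕ}

section Collapse

/-- The `ℕ × ℕ`-valued weights of the variables whose weighted degree is the bidegree: `t_i` has
weight `(1, 0)` and `X_k` has weight `(0, 1)`. A single weight makes the theory of weighted
homogeneous components available for bihomogeneous polynomials. -/
def bidegree (n : ℕ) : Fin n ⊕ Fin (n + 1) → ℕ × ℕ :=
  Sum.elim (fun _ => (1, 0)) (fun _ => (0, 1))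

theorem weight_bidegree (m : Fin n ⊕ Fin (n + 1) →₀ ℕ) :
    Finsupp.weight (bidegree n) m = (∑ i, m (Sum.inl i), ∑ k, m (Sum.inr k)) := by
  rw [Finsupp.weight_apply, Finsupp.sum_fintype _ _ (by simp), Fintype.sum_sum_type]
  ext <;> simp [bidegree, Prod.fst_sum, Prod.snd_sum]

theorem exists_ne_zero_of_weight_bidegree {m : Fin n ⊕ Fin (n + 1) →₀ ℕ} {a b : ℕ}
    (hm : Finsupp.weight (bidegree n) m = (a + 1, b)) : ∃ i, m (Sum.inl i) ≠ 0 := by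
  by_contra! h
  simp [weight_bidegree, h] at hm

theorem isBihomogeneous_iff {p : TX K n} {i j : ℕ} :
    IsBihomogeneous p i j ↔ IsWeightedHomogeneous (bidegree n) p (i, j) := by
  have hweight (m : Fin n ⊕ Fin (n + 1) →₀ ℕ) : Finsupp.weight (bidegree n) m =
      (Finsupp.weight (Sum.elim (fun _ => 1) (fun _ => 0) : Fin n ⊕ Fin (n + 1) → ℕ) m,
        Finsupp.weight (Sum.elim (fun _ => 0) (fun _ => 1) : Fin n ⊕ Fin (n + 1) → ℕ) m) := by
    rw [weight_bidegree]
    simp [Finsupp.weight_apply, Finsupp.sum_fintype, Fintype.sum_sum_type]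
  simp only [IsBihomogeneous, IsWeightedHomogeneous, hweight, Prod.mk.injEq]
  exact ⟨fun hp m hm => ⟨hp.1 hm, hp.2 hm⟩,
    fun hp => ⟨fun m hm => (hp hm).1, fun m hm => (hp hm).2⟩⟩

theorem isWeightedHomogeneous_tVar (i : Fin n) :
    IsWeightedHomogeneous (bidegree n) (tVar K i) (1, 0) :=
  isWeightedHomogeneous_X K (bidegree n) (Sum.inl i)

theorem isWeightedHomogeneous_xVar (k : Fin (n + 1)) :
    IsWeightedHomogeneous (bidegree n) (xVar K k) (0, 1) :=
  isWeightedHomogeneous_X K (bidegree n) (Sum.inr k)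

theorem isWeightedHomogeneous_minor (i j : Fin n) :
    IsWeightedHomogeneous (bidegree n) (minor K i j) (1, 1) :=
  ((isWeightedHomogeneous_tVar i).mul (isWeightedHomogeneous_xVar j.castSucc)).sub
    ((isWeightedHomogeneous_tVar j).mul (isWeightedHomogeneous_xVar i.castSucc))

theorem isWeightedHomogeneous_ofT {p : MvPolynomial (Fin n) K} {a : ℕ} (hp : p.IsHomogeneous a) :
    IsWeightedHomogeneous (bidegree n) (ofT p) (a, 0) :=
  isWeightedHomogeneous_rename (w := 1) (w' := bidegree n) (AddMonoidHom.inl ℕ ℕ)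
    (fun _ => rfl) hp

theorem isWeightedHomogeneous_ofX {p : MvPolynomial (Fin (n + 1)) K} {b : ℕ}
    (hp : p.IsHomogeneous b) : IsWeightedHomogeneous (bidegree n) (ofX p) (0, b) :=
  isWeightedHomogeneous_rename (w := 1) (w' := bidegree n) (AddMonoidHom.inr ℕ ℕ)
    (fun _ => rfl) hp

theorem isWeightedHomogeneous_sum_mul_xVar {G : Fin n → TX K n} {a b : ℕ}
    (hG : ∀ i, IsWeightedHomogeneous (bidegree n) (G i) (a, b)) :
    IsWeightedHomogeneous (bidegree n) (∑ i, G i * xVar K i.castSucc) (a, b + 1) :=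
  IsWeightedHomogeneous.sum _ _ _ fun i _ => (hG i).mul (isWeightedHomogeneous_xVar i.castSucc)

theorem exists_eq_sum_mul_tVar {p : TX K n} {a b : ℕ}
    (hp : IsWeightedHomogeneous (bidegree n) p (a + 1, b)) :
    ∃ G : Fin n → TX K n, (∀ i, IsWeightedHomogeneous (bidegree n) (G i) (a, b)) ∧
      p = ∑ i, G i * tVar K i :=
  exists_eq_sum_mul_X (D := (a, b)) (δ := (1, 0)) Sum.inl (fun _ => rfl)
    (fun _ => exists_ne_zero_of_weight_bidegree) hp

theorem exists_eq_sum_X_mul {p : MvPolynomial (Fin n) K} {a : ℕ} (hp : p.IsHomogeneous (a + 1)) :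
    ∃ G : Fin n → MvPolynomial (Fin n) K, (∀ i, (G i).IsHomogeneous a) ∧ p = ∑ i, X i * G i := by
  obtain ⟨G, hG, hpG⟩ := exists_eq_sum_mul_X (D := a) (δ := 1) (w := 1) id (fun _ => rfl)
    (fun m hm => by
      by_contra! h
      simp [Finsupp.weight_apply, Finsupp.sum_fintype, show ∀ i, m i = 0 from h] at hm) hp
  exact ⟨G, hG, by simpa only [mul_comm, id_eq] using hpG⟩

theorem exists_eq_ofX {p : TX K n} {b : ℕ} (hp : IsWeightedHomogeneous (bidegree n) p (0, b)) :
    ∃ P, ofX P = p := by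
  refine exists_rename_eq_of_vars_subset_range p Sum.inr Sum.inr_injective ?_
  rintro (i | k) hk
  · simpa using weight_eq_zero_of_mem_vars (isBihomogeneous_iff.mpr hp).1 hk
  · exact Set.mem_range_self k

theorem exists_eq_ofT {p : TX K n} {a : ℕ} (hp : IsWeightedHomogeneous (bidegree n) p (a, 0)) :
    ∃ P, ofT P = p := by
  refine exists_rename_eq_of_vars_subset_range p Sum.inl Sum.inl_injective ?_
  rintro (i | k) hk
  · exact Set.mem_range_self i
  · simpa using weight_eq_zero_of_mem_vars (isBihomogeneous_iff.mpr hp).2 hk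

/-- The substitution `t_i ↦ X_i`, which fixes every `X_k`. Restricted to a fixed bidegree, its
kernel is spanned by multiples of the `p_{ij}`, and it sends every `F_j` to `E`. -/
def collapse (K : Type*) [Field K] (n : ℕ) : TX K n →ₐ[K] MvPolynomial (Fin (n + 1)) K :=
  rename (Sum.elim Fin.castSucc id)

@[simp]
theorem collapse_tVar (i : Fin n) : collapse K n (tVar K i) = X i.castSucc := by
  simp [collapse, tVar]

@[simp]
theorem collapse_xVar (k : Fin (n + 1)) : collapse K n (xVar K k) = X k := by
  simp [collapse, xVar]

@[simp]
theorem collapse_ofT (p : MvPolynomial (Fin n) K) :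
    collapse K n (ofT p) = rename Fin.castSucc p := by
  rw [collapse, ofT, rename_rename, Sum.elim_comp_inl]

@[simp]
theorem collapse_ofX (P : MvPolynomial (Fin (n + 1)) K) : collapse K n (ofX P) = P := by
  rw [collapse, ofX, rename_rename, Sum.elim_comp_inr, rename_id_apply]

@[simp]
theorem collapse_minor (i j : Fin n) : collapse K n (minor K i j) = 0 := by
  simp [minor, mul_comm]

theorem eq_ofX_collapse {p : TX K n} {b : ℕ}
    (hp : IsWeightedHomogeneous (bidegree n) p (0, b)) : p = ofX (collapse K n p) := by
  obtain ⟨P, rfl⟩ := exists_eq_ofX hp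
  rw [collapse_ofX]

theorem eq_zero_of_collapse_eq_zero {p : TX K n} {a : ℕ}
    (hp : IsWeightedHomogeneous (bidegree n) p (a, 0)) (h : collapse K n p = 0) : p = 0 := by
  obtain ⟨P, rfl⟩ := exists_eq_ofT hp
  rw [collapse_ofT, map_eq_zero_iff _ (rename_injective _ (Fin.castSucc_injective n))] at h
  rw [h, ofT, map_zero]

theorem isHomogeneous_collapse {p : TX K n} {a b : ℕ}
    (hp : IsWeightedHomogeneous (bidegree n) p (a, b)) : (collapse K n p).IsHomogeneous (a + b) :=
  isWeightedHomogeneous_rename (w' := 1) (AddMonoidHom.coprod (.id ℕ) (.id ℕ))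
    (by rintro (i | k) <;> rfl) hp

theorem degreeOf_last_collapse_le {p : TX K n} {a b : ℕ}
    (hp : IsWeightedHomogeneous (bidegree n) p (a, b)) :
    degreeOf (Fin.last n) (collapse K n p) ≤ b := by
  classical
  rw [degreeOf_le_iff]
  intro e he
  obtain ⟨m, rfl, hm⟩ := coeff_rename_ne_zero _ _ _ (mem_support_iff.mp he)
  have hlast : m.mapDomain (Sum.elim Fin.castSucc id) (Fin.last n) = m (Sum.inr (Fin.last n)) := by
    simp [Finsupp.mapDomain, Finsupp.sum_fintype, Finsupp.single_apply,
      (Fin.castSucc_lt_last _).ne]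
  have hb := hp hm
  rw [weight_bidegree, Prod.mk.injEq] at hb
  rw [hlast, ← hb.2]
  exact Finset.single_le_sum (f := fun k => m (Sum.inr k)) (fun _ _ => Nat.zero_le _)
    (Finset.mem_univ (Fin.last n))

theorem exists_collapse_eq_monomial {a b : ℕ} {e : Fin (n + 1) →₀ ℕ} (he : e.degree = a + b)
    (hlast : e (Fin.last n) ≤ b) (r : K) :
    ∃ q : TX K n, IsWeightedHomogeneous (bidegree n) q (a, b) ∧
      collapse K n q = monomial e r := by
  have hinj := Fin.castSucc_injective n
  obtain ⟨α, hαe, hα⟩ : ∃ α ≤ e.comapDomain Fin.castSucc hinj.injOn, α.degree = a := by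
    refine Finsupp.exists_le_degree_eq _ _ ?_
    rw [Finsupp.degree_eq_sum, Fin.sum_univ_castSucc] at he
    rw [Finsupp.degree_eq_sum]
    simp only [Finsupp.comapDomain_apply]
    omega
  have hle : α.mapDomain Fin.castSucc ≤ e := by
    intro k
    induction k using Fin.lastCases with
    | last => rw [Finsupp.mapDomain_of_notMem_range _ _ (by simp)]; exact Nat.zero_le _
    | cast i => rw [Finsupp.mapDomain_apply hinj]; exact hαe i
  obtain ⟨β, rfl⟩ := le_iff_exists_add.mp hle
  have hβ : β.degree = b := by
    rw [map_add, Finsupp.degree_mapDomain, hα] at he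
    exact Nat.add_left_cancel he
  refine ⟨ofT (monomial α 1) * ofX (monomial β r), ?_, ?_⟩
  · simpa using (isWeightedHomogeneous_ofT (isHomogeneous_monomial (1 : K) hα)).mul
      (isWeightedHomogeneous_ofX (isHomogeneous_monomial r hβ))
  · rw [map_mul, collapse_ofT, collapse_ofX, rename_monomial, monomial_mul, one_mul]

theorem exists_collapse_eq {a b : ℕ} {P : MvPolynomial (Fin (n + 1)) K}
    (hP : P.IsHomogeneous (a + b)) (hlast : degreeOf (Fin.last n) P ≤ b) :
    ∃ q : TX K n, IsWeightedHomogeneous (bidegree n) q (a, b) ∧ collapse K n q = P := by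
  have hlift (e : Fin (n + 1) →₀ ℕ) (he : e ∈ P.support) : ∃ q : TX K n,
      IsWeightedHomogeneous (bidegree n) q (a, b) ∧ collapse K n q = monomial e (coeff e P) :=
    exists_collapse_eq_monomial
      (by rw [Finsupp.degree_eq_weight_one]; exact hP (mem_support_iff.mp he))
      ((monomial_le_degreeOf _ he).trans hlast) _
  choose! q hq hqP using hlift
  refine ⟨∑ e ∈ P.support, q e, IsWeightedHomogeneous.sum _ _ _ hq, ?_⟩
  rw [map_sum, Finset.sum_congr rfl hqP, support_sum_monomial_coeff]

end Collapse

section MinorIdeal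

/-- The ideal of all `p_{ij}`. -/
def minorIdeal (K : Type*) [Field K] (n : ℕ) : Ideal (TX K n) :=
  Ideal.span (Set.range fun q : {q : Fin n × Fin n // q.1 < q.2} => minor K q.1.1 q.1.2)

theorem minor_mem_minorIdeal (i j : Fin n) : minor K i j ∈ minorIdeal K n := by
  rcases lt_trichotomy i j with h | rfl | h
  · exact Ideal.subset_span ⟨⟨(i, j), h⟩, rfl⟩
  · simp [minor]
  · rw [show minor K i j = -minor K j i by simp [minor]]
    exact neg_mem (Ideal.subset_span ⟨⟨(j, i), h⟩, rfl⟩)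

theorem mapDomain_collapse_castSucc (m : Fin n ⊕ Fin (n + 1) →₀ ℕ) (i : Fin n) :
    m.mapDomain (Sum.elim Fin.castSucc id) i.castSucc =
      m (Sum.inl i) + m (Sum.inr i.castSucc) := by
  classical
  simp [Finsupp.mapDomain, Finsupp.sum_fintype, Finsupp.single_apply]

theorem exists_monomial_sub_tVar_mul_mem_minorIdeal {m : Fin n ⊕ Fin (n + 1) →₀ ℕ} {a b : ℕ}
    (hm : Finsupp.weight (bidegree n) m = (a + 1, b)) {i : Fin n}
    (hi : m.mapDomain (Sum.elim Fin.castSucc id) i.castSucc ≠ 0) :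
    ∃ m' : Fin n ⊕ Fin (n + 1) →₀ ℕ, Finsupp.weight (bidegree n) m' = (a, b) ∧
      m.mapDomain (Sum.elim Fin.castSucc id) =
        m'.mapDomain (Sum.elim Fin.castSucc id) + Finsupp.single i.castSucc 1 ∧
      monomial m (1 : K) - tVar K i * monomial m' 1 ∈ minorIdeal K n := by
  have hsplit (m : Fin n ⊕ Fin (n + 1) →₀ ℕ) (k) (hk : m k ≠ 0) :
      ∃ r, m = r + Finsupp.single k 1 :=
    ⟨_, (tsub_add_cancel_of_le (Finsupp.single_le_iff.mpr (Nat.one_le_iff_ne_zero.mpr hk))).symm⟩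
  rw [mapDomain_collapse_castSucc] at hi
  by_cases hti : m (Sum.inl i) = 0
  · -- `X_i` divides the monomial, and so does some `t_j`: trade `t_j X_i` for `t_i X_j`
    obtain ⟨j, hj⟩ := exists_ne_zero_of_weight_bidegree hm
    obtain ⟨m, rfl⟩ := hsplit m (Sum.inr i.castSucc) (by omega)
    obtain ⟨r, rfl⟩ := hsplit m (Sum.inl j) (by simpa using hj)
    refine ⟨r + Finsupp.single (Sum.inr j.castSucc) 1, ?_, ?_, ?_⟩
    · rw [add_right_comm, map_add, Finsupp.weight_single, one_smul] at hm
      have hrest :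
          Finsupp.weight (bidegree n) (r + Finsupp.single (Sum.inr i.castSucc) 1) = (a, b) :=
        add_right_cancel (b := ((1, 0) : ℕ × ℕ)) hm
      rw [map_add, Finsupp.weight_single] at hrest ⊢
      exact hrest
    · simp [Finsupp.mapDomain_add]
    · have hminor : monomial (r + Finsupp.single (Sum.inl j) 1 +
          Finsupp.single (Sum.inr i.castSucc) 1) (1 : K) -
          tVar K i * monomial (r + Finsupp.single (Sum.inr j.castSucc) 1) 1 =
          monomial r 1 * minor K j i := by
        simp only [monomial_add_single, minor, tVar, xVar]
        ring
      rw [hminor]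
      exact Ideal.mul_mem_left _ _ (minor_mem_minorIdeal j i)
  · obtain ⟨m', rfl⟩ := hsplit m (Sum.inl i) hti
    refine ⟨m', ?_, ?_, ?_⟩
    · rw [map_add, Finsupp.weight_single, one_smul] at hm
      exact add_right_cancel (b := ((1, 0) : ℕ × ℕ)) hm
    · simp [Finsupp.mapDomain_add]
    · rw [monomial_add_single, pow_one, mul_comm, tVar, sub_self]
      exact zero_mem _

theorem monomial_sub_monomial_mem_minorIdeal {m m' : Fin n ⊕ Fin (n + 1) →₀ ℕ} {a b : ℕ}
    (hm : Finsupp.weight (bidegree n) m = (a, b)) (hm' : Finsupp.weight (bidegree n) m' = (a, b))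
    (h : m.mapDomain (Sum.elim Fin.castSucc id) = m'.mapDomain (Sum.elim Fin.castSucc id)) :
    monomial m (1 : K) - monomial m' 1 ∈ minorIdeal K n := by
  induction a generalizing m m' with
  | zero =>
    rw [eq_ofX_collapse (isWeightedHomogeneous_monomial _ m (1 : K) hm),
      eq_ofX_collapse (isWeightedHomogeneous_monomial _ m' (1 : K) hm'),
      collapse, rename_monomial, rename_monomial, h, sub_self]
    exact zero_mem _
  | succ a ih =>
    obtain ⟨i, hi⟩ := exists_ne_zero_of_weight_bidegree hm
    have hci : m.mapDomain (Sum.elim Fin.castSucc id) i.castSucc ≠ 0 := by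
      rw [mapDomain_collapse_castSucc]
      omega
    obtain ⟨m₁, hm₁, hc, hmem⟩ := exists_monomial_sub_tVar_mul_mem_minorIdeal (K := K) hm hci
    obtain ⟨m₁', hm₁', hc', hmem'⟩ :=
      exists_monomial_sub_tVar_mul_mem_minorIdeal (K := K) hm' (h ▸ hci)
    have hdiff := ih hm₁ hm₁' (add_right_cancel (hc.symm.trans (h.trans hc')))
    convert add_mem (sub_mem hmem hmem') (Ideal.mul_mem_left _ (tVar K i) hdiff) using 1
    ring

theorem mem_minorIdeal_of_collapse_eq_zero {p : TX K n} {a b : ℕ}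
    (hp : IsWeightedHomogeneous (bidegree n) p (a, b)) (h : collapse K n p = 0) :
    p ∈ minorIdeal K n :=
  mem_of_rename_eq_zero (I := (minorIdeal K n).restrictScalars K) (fun _ hm _ hm' =>
    monomial_sub_monomial_mem_minorIdeal (hp (mem_support_iff.mp hm))
      (hp (mem_support_iff.mp hm'))) h

end MinorIdeal

section ImplicitEquation

variable {d : ℕ} {f g : MvPolynomial (Fin n) K}

theorem ne_zero_of_isRelPrime (hd : 1 ≤ d) (hg : g.IsHomogeneous d) (hfg : IsRelPrime f g) :
    f ≠ 0 := by
  rintro rfl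
  have hconst : constantCoeff g = 0 := by
    rw [constantCoeff_eq]
    exact hg.coeff_eq_zero (by rw [map_zero]; omega)
  have hunit := (isRelPrime_zero_left.mp hfg).map (constantCoeff (σ := Fin n) (R := K))
  exact hunit.ne_zero hconst

theorem last_notMem_vars_rename_castSucc (p : MvPolynomial (Fin n) K) :
    Fin.last n ∉ (rename Fin.castSucc p).vars := by
  intro h
  obtain ⟨i, -, hi⟩ := mem_vars_rename _ _ h
  exact (Fin.castSucc_lt_last i).ne hi

theorem irreducible_monoidEquation (hf0 : f ≠ 0) (hfg : IsRelPrime f g) :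
    Irreducible (monoidEquation f g) := by
  have hinj := Fin.castSucc_injective n
  rw [monoidEquation, sub_eq_add_neg]
  refine irreducible_mul_X_add _ _ _ ((map_ne_zero_iff _ (rename_injective _ hinj)).mpr hf0)
    (last_notMem_vars_rename_castSucc f) ?_ (isRelPrime_rename hinj hf0 hfg).neg_right
  rw [vars_neg]
  exact last_notMem_vars_rename_castSucc g

theorem isHomogeneous_monoidEquation (hd : 1 ≤ d) (hf : f.IsHomogeneous (d - 1))
    (hg : g.IsHomogeneous d) : (monoidEquation f g).IsHomogeneous d := by
  have hfX := (hf.rename_isHomogeneous (f := Fin.castSucc)).mul (isHomogeneous_X K (Fin.last n))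
  rw [Nat.sub_add_cancel hd] at hfX
  exact hfX.sub hg.rename_isHomogeneous

theorem one_le_degreeOf_monoidEquation (hf0 : f ≠ 0) :
    1 ≤ degreeOf (Fin.last n) (monoidEquation f g) := by
  have hinj := rename_injective (R := K) _ (Fin.castSucc_injective n)
  have hg0 : degreeOf (Fin.last n) (rename Fin.castSucc g) = 0 :=
    not_ne_iff.mp (mem_vars_iff_degreeOf_ne_zero.not.mp (last_notMem_vars_rename_castSucc g))
  have hle := degreeOf_add_le (Fin.last n) (monoidEquation f g) (rename Fin.castSucc g)
  rw [hg0, max_eq_left (Nat.zero_le _), monoidEquation, sub_add_cancel,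
    degreeOf_mul_eq ((map_ne_zero_iff _ hinj).mpr hf0) (X_ne_zero _), degreeOf_X_self] at hle
  exact le_of_add_le_right hle

theorem aeval_X_mul_eq {p : MvPolynomial (Fin n) K} {k : ℕ} (hp : p.IsHomogeneous k) :
    aeval (fun i => X i * f) p = f ^ k * p := by
  simpa [mul_comm] using aeval_pow_weight_mul (w := 1) f X hp

theorem aeval_X_mul_injective (hd : 1 ≤ d) (hf : f.IsHomogeneous (d - 1)) (hf0 : f ≠ 0) :
    Function.Injective (aeval (R := K) fun i : Fin n => X i * f) := by
  rw [injective_iff_map_eq_zero]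
  intro p hp
  have hX (i : Fin n) : (X i * f).IsHomogeneous (AddMonoidHom.mulLeft d 1) := by
    simpa [Nat.add_sub_cancel' hd] using (isHomogeneous_X K i).mul hf
  have hcomp (k : ℕ) : homogeneousComponent k p = 0 := by
    have hk : homogeneousComponent (d * k) (aeval (fun i => X i * f) p) =
        aeval (fun i => X i * f) (homogeneousComponent k p) :=
      weightedHomogeneousComponent_aeval (mul_right_injective₀ (by omega)) hX k p
    rw [hp, map_zero, aeval_X_mul_eq (homogeneousComponent_isHomogeneous k p), eq_comm] at hk
    exact (mul_eq_zero.mp hk).resolve_left (pow_ne_zero k hf0)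
  rw [← sum_homogeneousComponent p]
  exact Finset.sum_eq_zero fun k _ => hcomp k

theorem aeval_monoidParam_rename (p : MvPolynomial (Fin n) K) :
    aeval (monoidParam f g) (rename Fin.castSucc p) = aeval (fun i => X i * f) p := by
  rw [aeval_rename]
  congr 2
  ext1 i
  simp [monoidParam]

theorem aeval_monoidEquation (hd : 1 ≤ d) (hf : f.IsHomogeneous (d - 1)) (hg : g.IsHomogeneous d) :
    aeval (monoidParam f g) (monoidEquation f g) = 0 := by
  rw [monoidEquation, map_sub, map_mul, aeval_monoidParam_rename, aeval_monoidParam_rename,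
    aeval_X_mul_eq hf, aeval_X_mul_eq hg, aeval_X, ← pow_succ, Nat.sub_add_cancel hd]
  simp [monoidParam]

/-- Pseudo-division by `E`, which has degree one in `X_{n+1}` with leading coefficient `f`. -/
theorem exists_monoidEquation_dvd (f g : MvPolynomial (Fin n) K)
    (P : MvPolynomial (Fin (n + 1)) K) :
    ∃ (N : ℕ) (Q : MvPolynomial (Fin n) K),
      monoidEquation f g ∣ rename Fin.castSucc f ^ N * P - rename Fin.castSucc Q := by
  induction P using MvPolynomial.induction_on with
  | C r => exact ⟨0, C r, by simp⟩
  | add P₁ P₂ h₁ h₂ =>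
    obtain ⟨N₁, Q₁, A₁, h₁⟩ := h₁
    obtain ⟨N₂, Q₂, A₂, h₂⟩ := h₂
    refine ⟨N₁ + N₂, f ^ N₂ * Q₁ + f ^ N₁ * Q₂,
      rename Fin.castSucc f ^ N₂ * A₁ + rename Fin.castSucc f ^ N₁ * A₂, ?_⟩
    simp only [map_add, map_mul, map_pow]
    linear_combination rename Fin.castSucc f ^ N₂ * h₁ + rename Fin.castSucc f ^ N₁ * h₂
  | mul_X P k h =>
    obtain ⟨N, Q, A, h⟩ := h
    induction k using Fin.lastCases with
    | cast i =>
      refine ⟨N, Q * X i, A * X i.castSucc, ?_⟩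
      simp only [map_mul, rename_X]
      linear_combination X i.castSucc * h
    | last =>
      refine ⟨N + 1, Q * g, rename Fin.castSucc f ^ N * P + A * rename Fin.castSucc g, ?_⟩
      simp only [map_mul]
      rw [monoidEquation] at h ⊢
      linear_combination rename Fin.castSucc g * h

theorem isImplicitEquation_monoidEquation (hd : 1 ≤ d) (hf : f.IsHomogeneous (d - 1))
    (hg : g.IsHomogeneous d) (hfg : IsRelPrime f g) :
    IsImplicitEquation (monoidParam f g) (monoidEquation f g) := by
  have hf0 := ne_zero_of_isRelPrime hd hg hfg
  have hE := irreducible_monoidEquation hf0 hfg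
  have hvanish {P : MvPolynomial (Fin (n + 1)) K} (h : monoidEquation f g ∣ P) :
      aeval (monoidParam f g) P = 0 := by
    simpa only [aeval_monoidEquation hd hf hg, zero_dvd_iff] using
      map_dvd (aeval (monoidParam f g)) h
  refine ⟨hE, le_antisymm (fun P hP => Ideal.mem_span_singleton.mpr ?_)
    fun P hP => hvanish (Ideal.mem_span_singleton.mp hP)⟩
  rw [RingHom.mem_ker] at hP
  obtain ⟨N, Q, hQ⟩ := exists_monoidEquation_dvd f g P
  have hQ0 : Q = 0 := by
    have hQ' := hvanish hQ
    rw [map_sub, map_mul, hP, mul_zero, zero_sub, neg_eq_zero, aeval_monoidParam_rename] at hQ'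
    exact (injective_iff_map_eq_zero _).mp (aeval_X_mul_injective hd hf hf0) Q hQ'
  rw [hQ0, map_zero, sub_zero] at hQ
  refine (hE.prime.dvd_or_dvd hQ).resolve_left fun hdvd => ?_
  have hf' := hvanish (hE.prime.dvd_of_dvd_pow hdvd)
  rw [aeval_monoidParam_rename, aeval_X_mul_eq hf] at hf'
  exact mul_ne_zero (pow_ne_zero _ hf0) hf0 hf'

end ImplicitEquation

section ReesIdeal

/-- The images of the variables under `reesMap u`, with `K[t][Z]` encoded as `K[Z, t]` by letting
`X none` be `Z`; in this form `K[t][Z]` is graded by weights. -/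
def reesSubst (u : Fin (n + 1) → MvPolynomial (Fin n) K) :
    Fin n ⊕ Fin (n + 1) → MvPolynomial (Option (Fin n)) K :=
  Sum.elim (fun i => X (some i)) (fun k => X none * rename some (u k))

theorem mem_reesIdeal_iff {u : Fin (n + 1) → MvPolynomial (Fin n) K} {p : TX K n} :
    p ∈ reesIdeal u ↔ aeval (reesSubst u) p = 0 := by
  let ι : reesAlgebra (Ideal.span (Set.range u)) →ₐ[K] Polynomial (MvPolynomial (Fin n) K) :=
    (reesAlgebra (Ideal.span (Set.range u))).val.restrictScalars K
  have hsome (q : MvPolynomial (Fin n) K) :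
      optionEquivLeft K (Fin n) (rename some q) = Polynomial.C q := by
    induction q using MvPolynomial.induction_on with
    | C r => simp
    | add q₁ q₂ h₁ h₂ => simp only [map_add, h₁, h₂]
    | mul_X q i h => simp only [map_mul, h, rename_X, optionEquivLeft_X_some]
  have hι : ι.comp (reesMap u) =
      (optionEquivLeft K (Fin n)).toAlgHom.comp (aeval (reesSubst u)) := by
    ext (i | k) : 1
    · simp [ι, reesMap, reesSubst]
    · simp [ι, reesMap, reesSubst, hsome, Polynomial.X_mul_C, Polynomial.C_mul_X_eq_monomial]
  rw [reesIdeal, RingHom.mem_ker, ← map_eq_zero_iff (optionEquivLeft K (Fin n)).toAlgHom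
    (optionEquivLeft K (Fin n)).injective, ← map_eq_zero_iff ι Subtype.val_injective]
  exact iff_of_eq (congrArg (· = 0) (DFunLike.congr_fun hι p))

theorem weightedHomogeneousComponent_mem_reesIdeal {u : Fin (n + 1) → MvPolynomial (Fin n) K}
    {d : ℕ} (hu : ∀ k, (u k).IsHomogeneous d) {p : TX K n} (hp : p ∈ reesIdeal u) (D : ℕ × ℕ) :
    weightedHomogeneousComponent (bidegree n) D p ∈ reesIdeal u := by
  let w : Option (Fin n) → ℕ × ℕ := fun o => o.elim (0, 1) fun _ => (1, 0)
  let φ : ℕ × ℕ →+ ℕ × ℕ :=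
    (AddMonoidHom.coprod (.id ℕ) (AddMonoidHom.mulLeft d)).prod (AddMonoidHom.snd ℕ ℕ)
  have hφ : Function.Injective φ := by
    rintro ⟨a, b⟩ ⟨a', b'⟩ h
    obtain ⟨h₁, rfl⟩ : a + d * b = a' + d * b' ∧ b = b' := by simpa [φ] using h
    rw [add_right_cancel h₁]
  have hw (k) : IsWeightedHomogeneous w (reesSubst u k) (φ (bidegree n k)) := by
    rcases k with i | k
    · simpa [φ, w, bidegree, reesSubst] using isWeightedHomogeneous_X K w (some i)
    · have huk := isWeightedHomogeneous_rename (w := 1) (w' := w) (AddMonoidHom.inl ℕ ℕ)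
        (c := some) (fun _ => rfl) (hu k)
      simpa [φ, w, bidegree, reesSubst] using (isWeightedHomogeneous_X K w none).mul huk
  rw [mem_reesIdeal_iff] at hp ⊢
  rw [← weightedHomogeneousComponent_aeval hφ hw, hp, map_zero]

theorem mem_reesIdeal_iff_aeval {u : Fin (n + 1) → MvPolynomial (Fin n) K} {p : TX K n}
    {a b : ℕ} (hp : IsWeightedHomogeneous (bidegree n) p (a, b)) :
    p ∈ reesIdeal u ↔ aeval (Sum.elim X u) p = 0 := by
  have hsubst : aeval (reesSubst u) p = X none ^ b * rename some (aeval (Sum.elim X u) p) := by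
    rw [← AlgHom.comp_apply, comp_aeval,
      ← aeval_pow_weight_mul _ _ (isBihomogeneous_iff.mpr hp).2]
    congr 2
    ext1 (i | k) <;> simp [reesSubst]
  rw [mem_reesIdeal_iff, hsubst, mul_eq_zero_iff_left (pow_ne_zero b (X_ne_zero none)),
    map_eq_zero_iff _ (rename_injective some (Option.some_injective _))]

theorem isHomogeneous_monoidParam {d : ℕ} {f g : MvPolynomial (Fin n) K} (hd : 1 ≤ d)
    (hf : f.IsHomogeneous (d - 1)) (hg : g.IsHomogeneous d) (k : Fin (n + 1)) :
    (monoidParam f g k).IsHomogeneous d := by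
  induction k using Fin.lastCases with
  | last => simpa [monoidParam] using hg
  | cast i => simpa [monoidParam, Nat.add_sub_cancel' hd] using (isHomogeneous_X K i).mul hf

theorem aeval_monoidParam_collapse {f g : MvPolynomial (Fin n) K} {p : TX K n} {a b : ℕ}
    (hp : IsWeightedHomogeneous (bidegree n) p (a, b)) :
    aeval (monoidParam f g) (collapse K n p) =
      f ^ a * aeval (Sum.elim X (monoidParam f g)) p := by
  rw [collapse, aeval_rename, ← aeval_pow_weight_mul f _ (isBihomogeneous_iff.mpr hp).1]
  congr 2
  ext1 (i | k)
  · simp [monoidParam, mul_comm]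
  · simp

theorem mem_reesIdeal_iff_dvd_collapse {d : ℕ} {f g : MvPolynomial (Fin n) K} (hd : 1 ≤ d)
    (hf : f.IsHomogeneous (d - 1)) (hg : g.IsHomogeneous d) (hfg : IsRelPrime f g) {p : TX K n}
    {a b : ℕ} (hp : IsWeightedHomogeneous (bidegree n) p (a, b)) :
    p ∈ reesIdeal (monoidParam f g) ↔ monoidEquation f g ∣ collapse K n p := by
  rw [← Ideal.mem_span_singleton, ← (isImplicitEquation_monoidEquation hd hf hg hfg).2,
    RingHom.mem_ker, aeval_monoidParam_collapse hp, mem_reesIdeal_iff_aeval hp,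
    mul_eq_zero_iff_left (pow_ne_zero a (ne_zero_of_isRelPrime hd hg hfg))]

end ReesIdeal

section Sequence

variable {d : ℕ} {f g : MvPolynomial (Fin n) K} {F : ℕ → TX K n}

theorem isWeightedHomogeneous_start {k : ℕ} (hf : f.IsHomogeneous k)
    {a : Fin n → MvPolynomial (Fin n) K} (ha : ∀ i, (a i).IsHomogeneous k) :
    IsWeightedHomogeneous (bidegree n)
      (ofT f * xVar K (Fin.last n) - ∑ i, ofT (a i) * xVar K i.castSucc) (k, 1) :=
  ((isWeightedHomogeneous_ofT hf).mul (isWeightedHomogeneous_xVar (Fin.last n))).sub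
    (isWeightedHomogeneous_sum_mul_xVar fun i => isWeightedHomogeneous_ofT (ha i))

theorem exists_isMonoidSequence (hd : 1 ≤ d) (hf : f.IsHomogeneous (d - 1))
    (hg : g.IsHomogeneous d) : ∃ F : ℕ → TX K n, IsMonoidSequence d f g F := by
  rw [← Nat.sub_add_cancel hd] at hg
  obtain ⟨a, ha, hga⟩ := exists_eq_sum_X_mul hg
  have hdecomp (p : TX K n) (a b : ℕ) (hp : IsWeightedHomogeneous (bidegree n) p (a + 1, b)) :=
    exists_eq_sum_mul_tVar hp
  choose! G hG hGp using hdecomp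
  let H (k : ℕ) : TX K n :=
    Nat.rec (ofT f * xVar K (Fin.last n) - ∑ i, ofT (a i) * xVar K i.castSucc)
      (fun k p => ∑ i, G p (d - 2 - k) (k + 1) i * xVar K i.castSucc) k
  have hH (k : ℕ) (hk : k < d) : IsWeightedHomogeneous (bidegree n) (H k) (d - 1 - k, k + 1) := by
    induction k with
    | zero => exact isWeightedHomogeneous_start hf ha
    | succ k ih =>
      have hHk := ih (by omega)
      rw [show d - 1 - k = d - 2 - k + 1 by omega] at hHk
      rw [show d - 1 - (k + 1) = d - 2 - k by omega]
      exact isWeightedHomogeneous_sum_mul_xVar (hG _ _ _ hHk)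
  refine ⟨fun j => H (d - 1 - j), ⟨a, ha, hga, congrArg H (Nat.sub_self (d - 1))⟩, fun j hj => ?_⟩
  obtain ⟨k, rfl⟩ : ∃ k, d = j + k + 2 := ⟨d - j - 2, by omega⟩
  have hHk := hH k (by omega)
  rw [show j + k + 2 - 1 - k = j + 1 by omega] at hHk
  simp only [isBihomogeneous_iff, show j + k + 2 - (j + 1) = k + 1 by omega,
    show j + k + 2 - 1 - (j + 1) = k by omega, show j + k + 2 - 1 - j = k + 1 by omega]
  refine ⟨G (H k) j (k + 1), hG _ _ _ hHk, hGp _ _ _ hHk, ?_⟩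
  simp only [H, show j + k + 2 - 2 - k = j by omega]

theorem IsMonoidSequence.isWeightedHomogeneous (hF : IsMonoidSequence d f g F)
    (hf : f.IsHomogeneous (d - 1)) {j : ℕ} (hj : j < d) :
    IsWeightedHomogeneous (bidegree n) (F j) (j, d - j) := by
  rcases Nat.lt_or_ge (j + 1) d with hjd | hjd
  · obtain ⟨G, hG, -, hFj⟩ := hF.step j hjd
    rw [hFj, show d - j = d - (j + 1) + 1 by omega]
    exact isWeightedHomogeneous_sum_mul_xVar fun i => isBihomogeneous_iff.mp (hG i)
  · obtain ⟨a, ha, -, hFd⟩ := hF.start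
    obtain rfl : j = d - 1 := by omega
    rw [hFd, show d - (d - 1) = 1 by omega]
    exact isWeightedHomogeneous_start hf ha

theorem IsMonoidSequence.collapse_eq (hF : IsMonoidSequence d f g F) {j : ℕ} (hj : j < d) :
    collapse K n (F j) = monoidEquation f g := by
  induction Nat.le_sub_one_of_lt hj using Nat.decreasingInduction with
  | self =>
    obtain ⟨a, -, hga, hFd⟩ := hF.start
    simp [hFd, hga, monoidEquation, mul_comm]
  | of_succ k hk ih =>
    obtain ⟨G, -, hF₁, hF₀⟩ := hF.step k (by omega)
    rw [← ih (by omega), hF₁, hF₀]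
    simp only [map_sum, map_mul, collapse_tVar, collapse_xVar]

end Sequence

section Generation

variable {d : ℕ} {f g : MvPolynomial (Fin n) K} {F : ℕ → TX K n}

theorem exists_isHomogeneous_mul_monoidEquation (hd : 1 ≤ d) (hf : f.IsHomogeneous (d - 1))
    (hg : g.IsHomogeneous d) {P : MvPolynomial (Fin (n + 1)) K} (hP0 : P ≠ 0) {k : ℕ}
    (hP : P.IsHomogeneous k) (hE : monoidEquation f g ∣ P) :
    ∃ (l : ℕ) (Q : MvPolynomial (Fin (n + 1)) K),
      l + d = k ∧ Q.IsHomogeneous l ∧ P = Q * monoidEquation f g := by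
  obtain ⟨c, -, hc, hc0, hPc⟩ := exists_isWeightedHomogeneous_coeff_of_mem_span
    (s := fun _ : Unit => monoidEquation f g) (A := Set.univ)
    (fun _ => isHomogeneous_monoidEquation hd hf hg) hP
    (by simpa [Ideal.mem_span_singleton] using hE)
  rw [Fintype.sum_unique] at hPc
  obtain ⟨l, hl⟩ : ∃ l, l + d = k := by
    by_contra! h
    exact hP0 (by rw [hPc, hc0 _ h, zero_mul])
  exact ⟨l, c default, hl, hc _ l hl, hPc⟩

theorem mem_of_monoidEquation_dvd_collapse (hd : 1 ≤ d) (hf : f.IsHomogeneous (d - 1))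
    (hg : g.IsHomogeneous d) (hf0 : f ≠ 0) (hF : IsMonoidSequence d f g F) {I : Ideal (TX K n)}
    (hI : minorIdeal K n ≤ I) (hFI : ∀ j < d, F j ∈ I) {p : TX K n} {a b : ℕ}
    (hp : IsWeightedHomogeneous (bidegree n) p (a, b))
    (hE : monoidEquation f g ∣ collapse K n p) : p ∈ I := by
  by_cases hp0 : collapse K n p = 0
  · exact hI (mem_minorIdeal_of_collapse_eq_zero hp hp0)
  obtain ⟨l, Q, hl, hQ, hpQ⟩ :=
    exists_isHomogeneous_mul_monoidEquation hd hf hg hp0 (isHomogeneous_collapse hp) hE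
  have hlast : degreeOf (Fin.last n) Q + 1 ≤ b := by
    have hb := degreeOf_last_collapse_le hp
    rw [hpQ] at hp0 hb
    rw [degreeOf_mul_eq (left_ne_zero_of_mul hp0) (right_ne_zero_of_mul hp0)] at hb
    have := one_le_degreeOf_monoidEquation (g := g) hf0
    omega
  have hlastl : degreeOf (Fin.last n) Q ≤ l := (degreeOf_le_totalDegree Q _).trans hQ.totalDegree_le
  -- the largest index for which `F m` has degree at most `a` in `t`
  obtain ⟨m, hm⟩ : ∃ m, m = min a (d - 1) := ⟨_, rfl⟩
  obtain ⟨q, hq, hqQ⟩ := exists_collapse_eq (a := a - m) (b := b - (d - m))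
    (by rwa [show a - m + (b - (d - m)) = l by omega]) (by omega)
  have hqF := hq.mul (hF.isWeightedHomogeneous hf (j := m) (by omega))
  rw [Prod.mk_add_mk, Nat.sub_add_cancel (by omega), Nat.sub_add_cancel (by omega)] at hqF
  have hsub : p - q * F m ∈ minorIdeal K n := by
    refine mem_minorIdeal_of_collapse_eq_zero (hp.sub hqF) ?_
    rw [map_sub, map_mul, hqQ, hF.collapse_eq (by omega), hpQ, sub_self]
  exact (Ideal.add_mem_iff_left I (I.neg_mem (I.mul_mem_left q (hFI m (by omega))))).mp
    (by simpa [sub_eq_add_neg] using hI hsub)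

theorem span_monoidGenerators (hd : 1 ≤ d) (hf : f.IsHomogeneous (d - 1))
    (hg : g.IsHomogeneous d) (hfg : IsRelPrime f g) (hF : IsMonoidSequence d f g F) :
    Ideal.span (Set.range (monoidGenerators d F)) = reesIdeal (monoidParam f g) := by
  apply le_antisymm
  · rw [Ideal.span_le]
    rintro _ ⟨q | j, rfl⟩
    · refine (mem_reesIdeal_iff_dvd_collapse hd hf hg hfg
        (isWeightedHomogeneous_minor q.1.1 q.1.2)).mpr ?_
      rw [collapse_minor]
      exact dvd_zero _
    · refine (mem_reesIdeal_iff_dvd_collapse hd hf hg hfg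
        (hF.isWeightedHomogeneous hf j.2)).mpr ?_
      rw [hF.collapse_eq j.2]
  · intro p hp
    have hminor : minorIdeal K n ≤ Ideal.span (Set.range (monoidGenerators d F)) := by
      rw [minorIdeal, Ideal.span_le]
      rintro _ ⟨q, rfl⟩
      exact Ideal.subset_span ⟨Sum.inl q, rfl⟩
    have hseq (j : ℕ) (hj : j < d) : F j ∈ Ideal.span (Set.range (monoidGenerators d F)) :=
      Ideal.subset_span ⟨Sum.inr ⟨j, hj⟩, rfl⟩
    rw [← sum_weightedHomogeneousComponent (bidegree n) p,
      finsum_eq_sum _ (weightedHomogeneousComponent_finsupp p)]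
    refine sum_mem fun D _ => ?_
    have hD := weightedHomogeneousComponent_isWeightedHomogeneous (w := bidegree n) D p
    have hDp := weightedHomogeneousComponent_mem_reesIdeal (isHomogeneous_monoidParam hd hf hg) hp D
    exact mem_of_monoidEquation_dvd_collapse hd hf hg (ne_zero_of_isRelPrime hd hg hfg) hF hminor
      hseq hD ((mem_reesIdeal_iff_dvd_collapse hd hf hg hfg hD).mp hDp)

end Generation

section Minimality

variable {d : ℕ} {f g : MvPolynomial (Fin n) K} {F : ℕ → TX K n}

theorem IsMonoidSequence.isWeightedHomogeneous_monoidGenerators (hF : IsMonoidSequence d f g F)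
    (hf : f.IsHomogeneous (d - 1)) (i : {q : Fin n × Fin n // q.1 < q.2} ⊕ Fin d) :
    IsWeightedHomogeneous (bidegree n) (monoidGenerators d F i)
      (Sum.elim (fun _ => (1, 1)) (fun j : Fin d => ((j : ℕ), d - j)) i) := by
  rcases i with q | j
  · exact isWeightedHomogeneous_minor q.1.1 q.1.2
  · exact hF.isWeightedHomogeneous hf j.2

theorem sequence_notMem_span (hF : IsMonoidSequence d f g F) (hf : f.IsHomogeneous (d - 1))
    (hE : monoidEquation f g ≠ 0) (j : Fin d) :
    F j ∉ Ideal.span (monoidGenerators d F '' {Sum.inr j}ᶜ) := by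
  intro h
  obtain ⟨c, hcA, -, hc0, hFj⟩ := exists_isWeightedHomogeneous_coeff_of_mem_span
    (hF.isWeightedHomogeneous_monoidGenerators hf) (hF.isWeightedHomogeneous hf j.2) h
  have hcF (k : Fin d) : c (Sum.inr k) = 0 := by
    rcases eq_or_ne k j with rfl | hkj
    · exact hcA _ (by simp)
    · refine hc0 _ fun D hD => hkj (Fin.ext ?_)
      simp only [Sum.elim_inr, Prod.ext_iff, Prod.fst_add, Prod.snd_add] at hD
      omega
  apply hE
  rw [← hF.collapse_eq j.2, hFj]
  simp [monoidGenerators, hcF]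

theorem minor_notMem_span_minor (q : {q : Fin n × Fin n // q.1 < q.2}) :
    minor K q.1.1 q.1.2 ∉ Ideal.span
      ((fun q : {q : Fin n × Fin n // q.1 < q.2} => minor K q.1.1 q.1.2) '' {q}ᶜ) := by
  classical
  obtain ⟨⟨i, j⟩, hij⟩ := q
  intro h
  -- evaluation at `t = e_i`, `X = e_j` separates `p_{ij}` from the other minors
  let φ : TX K n →ₐ[K] K := aeval (Sum.elim (Pi.single i 1) (Pi.single j.castSucc 1))
  have hφ (k l : Fin n) : φ (minor K k l) =
      (if k = i ∧ l = j then 1 else 0) - if l = i ∧ k = j then 1 else 0 := by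
    simp [φ, minor, tVar, xVar, Pi.single_apply, ← ite_and, and_comm]
  have hker : Ideal.span ((fun q : {q : Fin n × Fin n // q.1 < q.2} =>
      minor K q.1.1 q.1.2) '' {⟨(i, j), hij⟩}ᶜ) ≤ RingHom.ker φ := by
    rw [Ideal.span_le]
    rintro _ ⟨⟨⟨k, l⟩, hkl⟩, hne, rfl⟩
    change φ (minor K k l) = 0
    rw [hφ, if_neg, if_neg, sub_zero]
    · rintro ⟨rfl, rfl⟩
      exact lt_asymm hij hkl
    · rintro ⟨rfl, rfl⟩
      exact hne rfl
  have hφij : φ (minor K i j) = 0 := hker h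
  rw [hφ, if_pos ⟨rfl, rfl⟩, if_neg fun hji => hij.ne' hji.1, sub_zero] at hφij
  exact one_ne_zero hφij

theorem minor_notMem_span (hF : IsMonoidSequence d f g F) (hf : f.IsHomogeneous (d - 1))
    (hE : monoidEquation f g ≠ 0) (q : {q : Fin n × Fin n // q.1 < q.2}) :
    minor K q.1.1 q.1.2 ∉ Ideal.span (monoidGenerators d F '' {Sum.inl q}ᶜ) := by
  intro h
  obtain ⟨c, hcA, hch, hc0, hq⟩ := exists_isWeightedHomogeneous_coeff_of_mem_span
    (hF.isWeightedHomogeneous_monoidGenerators hf)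
    (isWeightedHomogeneous_minor (K := K) q.1.1 q.1.2) h
  have hbideg (k : Fin d) (hk : c (Sum.inr k) ≠ 0) : (k : ℕ) + 1 = d ∧
      ∃ a, IsWeightedHomogeneous (bidegree n) (c (Sum.inr k)) (a, 0) := by
    obtain ⟨⟨a, b⟩, hab⟩ := not_forall_not.mp (mt (hc0 (Sum.inr k)) hk)
    have hab' := hab
    simp only [Sum.elim_inr, Prod.mk_add_mk, Prod.mk.injEq] at hab'
    obtain rfl : b = 0 := by omega
    exact ⟨by omega, a, hch _ _ hab⟩
  have hcF (k : Fin d) : c (Sum.inr k) = 0 := by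
    by_contra hk
    obtain ⟨hkd, a, ha⟩ := hbideg k hk
    have hsum : ∑ k, collapse K n (c (Sum.inr k)) = 0 := by
      have hcol := congrArg (collapse K n) hq
      simp only [Fintype.sum_sum_type, monoidGenerators, map_add, map_sum, map_mul, Sum.elim_inl,
        Sum.elim_inr, collapse_minor, hF.collapse_eq (Fin.is_lt _), mul_zero,
        Finset.sum_const_zero, zero_add, ← Finset.sum_mul] at hcol
      exact (mul_eq_zero.mp hcol.symm).resolve_right hE
    rw [Fintype.sum_eq_single k] at hsum
    · exact hk (eq_zero_of_collapse_eq_zero ha hsum)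
    · intro k' hk'
      by_contra hck'
      exact hk' (Fin.ext (by have := (hbideg k' fun h => hck' (by rw [h, map_zero])).1; omega))
  refine minor_notMem_span_minor (K := K) q ?_
  rw [hq, Fintype.sum_sum_type]
  simp only [hcF, zero_mul, Finset.sum_const_zero, add_zero]
  refine sum_mem fun q' _ => ?_
  rcases eq_or_ne q' q with rfl | hne
  · rw [hcA _ (by simp), zero_mul]
    exact zero_mem _
  · exact Ideal.mul_mem_left _ _ (Ideal.subset_span ⟨q', hne, rfl⟩)

end Minimality

end MonoidRees

end

theorem theorem3p1 {K : Type*} [Field K] (n d : ℕ) (hn : 1 ≤ n) (hd : 1 ≤ d)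
    (f g : MvPolynomial (Fin n) K)
    (hf : f.IsHomogeneous (d - 1)) (hg : g.IsHomogeneous d) (hfg : IsRelPrime f g) :
    MonoidRees.IsImplicitEquation (MonoidRees.monoidParam f g) (MonoidRees.monoidEquation f g) ∧
    (∃ F : ℕ → MonoidRees.TX K n, MonoidRees.IsMonoidSequence d f g F) ∧
    ∀ F : ℕ → MonoidRees.TX K n, MonoidRees.IsMonoidSequence d f g F →
      F 0 = MonoidRees.ofX (MonoidRees.monoidEquation f g) ∧
      MonoidRees.IsMinimalGenerators (MonoidRees.reesIdeal (MonoidRees.monoidParam f g))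
        (MonoidRees.monoidGenerators d F) := by
  have himp := MonoidRees.isImplicitEquation_monoidEquation hd hf hg hfg
  refine ⟨himp, MonoidRees.exists_isMonoidSequence hd hf hg, fun F hF => ⟨?_, ?_, ?_⟩⟩
  · rw [← hF.collapse_eq hd]
    exact MonoidRees.eq_ofX_collapse (hF.isWeightedHomogeneous hf hd)
  · exact MonoidRees.span_monoidGenerators hd hf hg hfg hF
  · rintro (q | j)
    · exact MonoidRees.minor_notMem_span hF hf himp.1.ne_zero q
    · exact MonoidRees.sequence_notMem_span hF hf himp.1.ne_zero j
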